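/- Let $d\ge 3$ and let $p\in\mathbb{C}[z]$ be a monic polynomial of degree $d$ with pairwise distinct roots. One step of the Gauss–Seidel variant of the Weierstrass method for $p$ takes $(z_1,\dots,z_d)\in\mathbb{C}^d$ and, for $i=1,\dots,d$ in this order, replaces $z_i$ by $$z_i-\frac{p(z_i)}{\prod_{j\ne i}(z_i-z_j)},$$ where each replacement uses the current (already updated) values of the other coordinates; the step is well defined if none of these $d$ denominators vanishes. Then this method has orbits in $\mathbb{C}^d$ that diverge to infinity: there is a sequence $(z^{(m)})_{m\ge 0}$ in $\mathbb{C}^d$ such that for every $m$ the step is well defined at $z^{(m)}$ and sends it to $z^{(m+1)}$, and $\|z^{(m)}\|\to\infty$ as $m\to\infty$. -/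

import Mathlib

open Polynomial Filter

noncomputable section

/-- The Weierstrass update of the `i`-th coordinate,
`z_i - p(z_i) / ∏_{j ≠ i} (z_i - z_j)`. -/
def weierstrassUpdate {n : ℕ} (p : ℂ[X]) (z : Fin n → ℂ) (i : Fin n) : ℂ :=
  z i - p.eval (z i) / ∏ j ∈ Finset.univ.erase i, (z i - z j)

/-- The approximation vector after the first `k` passes of the Gauss–Seidel loop:
coordinates `0, …, k - 1` have been replaced, one after the other, each update using
the current values of all the other coordinates. -/
def gswPartial {n : ℕ} (p : ℂ[X]) (z : Fin n → ℂ) : ℕ → Fin n → ℂ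
  | 0 => z
  | k + 1 =>
    if h : k < n then
      Function.update (gswPartial p z k) ⟨k, h⟩ (weierstrassUpdate p (gswPartial p z k) ⟨k, h⟩)
    else gswPartial p z k

/-- One full step of the Gauss–Seidel variant of the Weierstrass method. -/
def GSW {n : ℕ} (p : ℂ[X]) (z : Fin n → ℂ) : Fin n → ℂ :=
  gswPartial p z n

/-- The Gauss–Seidel step at `z` is well defined: no denominator vanishes in any of
its `n` successive coordinate updates. -/
def GSWDefinedAt {n : ℕ} (p : ℂ[X]) (z : Fin n → ℂ) : Prop :=
  ∀ i : Fin n, ∏ j ∈ Finset.univ.erase i, (gswPartial p z i i - gswPartial p z i j) ≠ 0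

/-- `z` is an infinite forward orbit in `ℂⁿ` of the Gauss–Seidel Weierstrass method for `p`. -/
def IsGSWOrbit {n : ℕ} (p : ℂ[X]) (z : ℕ → Fin n → ℂ) : Prop :=
  ∀ m : ℕ, GSWDefinedAt p (z m) ∧ z (m + 1) = GSW p (z m)

end

/-! Listing the successive updates in one sequence turns the method into the recurrence `∏_{j=1}^d
(y_k - y_{k+j}) = p(y_k)`, as long as `p(y_k) ≠ 0`. For `p = z^d` it has the solutions `y_k = c μ^k`
with `∏_{j=1}^d (1 - μ^j) = 1`, and some such `μ` has `|μ| > 1` (`exists_prod_one_sub_pow_eq_one`).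

Near infinity `p` is a perturbation of `z^d`. Put `y_n = ε⁻¹ μ^n (1 + ρ^n v_n)` with `v` bounded and
`1/|μ| < ρ < 1`; the lower-order terms of `p` then carry positive powers of `ε`. At `ε = 0`, `v = 0`
is a solution, and the linearisation in `v` is a polynomial in `ρ` times the left shift. It is
surjective once `ρ` avoids the moduli of the polynomial's roots (`surjective_aeval_smul_leftShift`),
so solutions persist for small `ε ≠ 0` (`exists_prod_eq_perturbed_pow`) and grow like `|μ|^n`. -/

open scoped BoundedContinuousFunction

/-! ### An expanding multiplier for `z^d` -/

/-- A polynomial with all its roots in the closed unit disc is larger at `2` than its reversal. -/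
theorem norm_eval_two_ge_of_roots_le_one (f : ℂ[X]) (h : ∀ a ∈ f.roots, ‖a‖ ≤ 1) :
    2 ^ f.natDegree * ‖f.eval (1 / 2)‖ ≤ ‖f.eval 2‖ := by
  have hs : f.Splits := IsAlgClosed.splits f
  have key : ∀ s : Multiset ℂ, (∀ a ∈ s, ‖a‖ ≤ 1) →
      2 ^ s.card * ‖(s.map fun a => (1 / 2 : ℂ) - a).prod‖ ≤ ‖(s.map fun a => 2 - a).prod‖ := by
    intro s
    induction s using Multiset.induction with
    | empty => simp
    | cons a s ih =>
      intro hs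
      have ha : ‖a‖ ≤ 1 := hs a (Multiset.mem_cons_self a s)
      -- `|2 - a|² - 4 |1/2 - a|² = 3 (1 - |a|²)`.
      have h1 : 2 * ‖(1 / 2 : ℂ) - a‖ ≤ ‖2 - a‖ := by
        have e1 : ‖(1 / 2 : ℂ) - a‖ ^ 2 = (1 / 2 - a.re) ^ 2 + a.im ^ 2 := by
          rw [← Complex.normSq_eq_norm_sq, Complex.normSq_apply]; simp; ring
        have e2 : ‖2 - a‖ ^ 2 = (2 - a.re) ^ 2 + a.im ^ 2 := by
          rw [← Complex.normSq_eq_norm_sq, Complex.normSq_apply]; simp; ring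
        have e3 : ‖a‖ ^ 2 = a.re ^ 2 + a.im ^ 2 := by
          rw [← Complex.normSq_eq_norm_sq, Complex.normSq_apply]; ring
        have e4 : ‖a‖ ^ 2 ≤ 1 := pow_le_one₀ (norm_nonneg a) ha
        refine le_of_sq_le_sq ?_ (norm_nonneg _)
        rw [mul_pow, e1, e2]
        linarith
      have h2 := ih fun b hb => hs b (Multiset.mem_cons_of_mem hb)
      simp only [Multiset.map_cons, Multiset.prod_cons, Multiset.card_cons, norm_mul]
      calc _ = (2 * ‖(1 / 2 : ℂ) - a‖) *
            (2 ^ s.card * ‖(s.map fun a => (1 / 2 : ℂ) - a).prod‖) := by ring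
        _ ≤ _ := by gcongr
  have e : ∀ x, f.eval x = f.leadingCoeff * (f.roots.map fun a => x - a).prod := by
    intro x
    conv_lhs => rw [hs.eq_prod_roots]
    simp [eval_multiset_prod, Multiset.map_map]
  rw [e, e, norm_mul, norm_mul, hs.natDegree_eq_card_roots]
  have := mul_le_mul_of_nonneg_left (key _ h) (norm_nonneg f.leadingCoeff)
  linarith

theorem prod_one_sub_half_pow_le (d : ℕ) (hd : 2 ≤ d) :
    0 ≤ ∏ j ∈ Finset.range d, (1 - (1 / 2 : ℝ) ^ (j + 1)) ∧
      ∏ j ∈ Finset.range d, (1 - (1 / 2 : ℝ) ^ (j + 1)) ≤ 3 / 8 := by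
  induction d, hd using Nat.le_induction with
  | base => norm_num [Finset.prod_range_succ]
  | succ d hd ih =>
    rw [Finset.prod_range_succ]
    have h1 : (1 / 2 : ℝ) ^ (d + 1) ≤ 1 := pow_le_one₀ (by norm_num) (by norm_num)
    have h2 : (0 : ℝ) ≤ (1 / 2 : ℝ) ^ (d + 1) := by positivity
    exact ⟨mul_nonneg ih.1 (by linarith),
      (mul_le_of_le_one_right ih.1 (by linarith)).trans ih.2⟩

theorem natDegree_prod_one_sub_X_pow (d : ℕ) :
    (∏ j ∈ Finset.range d, (1 - X ^ (j + 1) : ℂ[X])).natDegree =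
      ∑ j ∈ Finset.range d, (j + 1) := by
  have h1 : ∀ j : ℕ, (1 - X ^ (j + 1) : ℂ[X]).natDegree = j + 1 := by
    intro j
    rw [← natDegree_neg, neg_sub]
    exact natDegree_X_pow_sub_C (r := (1 : ℂ))
  rw [natDegree_prod]
  · simp [h1]
  · intro j _ h0
    have := h1 j
    rw [h0] at this
    simp at this

/-- Let `F = ∏ (1 - X^j)`, of degree `N`, and `P = F(1/2) ≤ 3/8`, so that `|F(2)| = 2^N P`. If all
roots of `F - 1` were in the closed unit disc, then `2^N (1 - P) ≤ 2^N P + 1`, hence `2^N ≤ 4`,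
whereas `N ≥ 3`. -/
theorem exists_prod_one_sub_pow_eq_one (d : ℕ) (hd : 2 ≤ d) :
    ∃ μ : ℂ, 1 < ‖μ‖ ∧ ∏ j ∈ Finset.range d, (1 - μ ^ (j + 1)) = 1 := by
  set N := ∑ j ∈ Finset.range d, (j + 1) with hN
  have hN3 : 3 ≤ N := by
    calc 3 = ∑ j ∈ Finset.range 2, (j + 1) := by simp [Finset.sum_range_succ]
      _ ≤ N := Finset.sum_le_sum_of_subset (Finset.range_subset_range.2 hd)
  set F : ℂ[X] := ∏ j ∈ Finset.range d, (1 - X ^ (j + 1)) with hF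
  have hFd : F.natDegree = N := natDegree_prod_one_sub_X_pow d
  have hfd : (F - C 1).natDegree = N := by rw [natDegree_sub_C, hFd]
  have hF0 : F - C 1 ≠ 0 := by
    intro h0
    rw [h0] at hfd
    simp at hfd
    omega
  have hev : ∀ x, F.eval x = ∏ j ∈ Finset.range d, (1 - x ^ (j + 1)) := by
    intro x
    simp [hF, eval_prod]
  by_contra! hcon
  have hroots : ∀ a ∈ (F - C 1).roots, ‖a‖ ≤ 1 := by
    intro a ha
    by_contra! h
    refine hcon a h ?_
    have := (mem_roots hF0).1 ha
    rw [IsRoot.def, eval_sub, eval_C, sub_eq_zero, hev] at this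
    exact this
  have main := norm_eval_two_ge_of_roots_le_one _ hroots
  obtain ⟨hP0, hP⟩ := prod_one_sub_half_pow_le d hd
  set P := ∏ j ∈ Finset.range d, (1 - (1 / 2 : ℝ) ^ (j + 1)) with hPdef
  have h1 : F.eval (1 / 2) = (P : ℂ) := by
    rw [hev, hPdef]
    push_cast
    rfl
  have h2 : ‖F.eval 2‖ = 2 ^ N * P := by
    rw [hev, hPdef, hN, ← Finset.prod_pow_eq_pow_sum, ← Finset.prod_mul_distrib, norm_prod]
    refine Finset.prod_congr rfl fun j _ => ?_
    have : (1 : ℝ) ≤ 2 ^ (j + 1) := one_le_pow₀ (by norm_num)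
    rw [norm_sub_rev, mul_sub, ← mul_pow]
    have e : (2 : ℂ) ^ (j + 1) - 1 = ((2 ^ (j + 1) - 1 : ℝ) : ℂ) := by push_cast; rfl
    rw [e, Complex.norm_real, Real.norm_of_nonneg (by linarith)]
    norm_num
  rw [hfd, eval_sub, eval_sub, eval_C, eval_C, h1] at main
  have h3 : 5 / 8 ≤ ‖(P : ℂ) - 1‖ := by
    have e : (P : ℂ) - 1 = ((P - 1 : ℝ) : ℂ) := by push_cast; rfl
    rw [e, Complex.norm_real, Real.norm_eq_abs]
    linarith [neg_le_abs (P - 1)]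
  have h4 : ‖F.eval 2 - 1‖ ≤ 2 ^ N * P + 1 := by
    refine (norm_sub_le _ _).trans ?_
    rw [h2, norm_one]
  have h5 : (8 : ℝ) ≤ 2 ^ N := by
    calc (8 : ℝ) = 2 ^ 3 := by norm_num
      _ ≤ 2 ^ N := pow_le_pow_right₀ (by norm_num) hN3
  nlinarith

/-! ### Polynomials in the weighted left shift -/

/-- The left shift on bounded sequences. -/
noncomputable def leftShift : (ℕ →ᵇ ℂ) →L[ℂ] (ℕ →ᵇ ℂ) :=
  LinearMap.mkContinuous
    { toFun := fun v => v.compContinuous ⟨Nat.succ, continuous_of_discreteTopology⟩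
      map_add' := fun _ _ => rfl
      map_smul' := fun _ _ => rfl } 1 (fun v => by
        rw [one_mul]
        exact (BoundedContinuousFunction.norm_le (norm_nonneg v)).2 fun n => v.norm_coe_le_norm _)

theorem leftShift_apply (v : ℕ →ᵇ ℂ) (n : ℕ) : leftShift v n = v (n + 1) := rfl

theorem norm_leftShift_le : ‖leftShift‖ ≤ 1 := LinearMap.mkContinuous_norm_le _ zero_le_one _

theorem smul_leftShift_pow_apply (c : ℂ) (v : ℕ →ᵇ ℂ) (j n : ℕ) :
    ((c • leftShift) ^ j) v n = c ^ j * v (n + j) := by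
  induction j generalizing n with
  | zero => simp
  | succ j ih =>
    rw [pow_succ', mul_apply_eq_comp]
    change c * ((c • leftShift) ^ j) v (n + 1) = _
    rw [ih, pow_succ', mul_assoc, add_assoc, add_comm 1 j]

theorem exists_leftShift_mul_eq_one :
    ∃ B : (ℕ →ᵇ ℂ) →L[ℂ] (ℕ →ᵇ ℂ), ‖B‖ ≤ 1 ∧ leftShift * B = 1 := by
  let b : (ℕ →ᵇ ℂ) → ℕ → ℂ := fun v n => if n = 0 then 0 else v (n - 1)
  have hb : ∀ v n, ‖b v n‖ ≤ ‖v‖ := by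
    intro v n
    by_cases h : n = 0
    · simp [b, h]
    · simpa [b, h] using v.norm_coe_le_norm (n - 1)
  let B₀ : (ℕ →ᵇ ℂ) →ₗ[ℂ] (ℕ →ᵇ ℂ) :=
    { toFun := fun v => BoundedContinuousFunction.ofNormedAddCommGroup (b v)
        continuous_of_discreteTopology ‖v‖ (hb v)
      map_add' := fun u v => by
        ext n
        by_cases h : n = 0 <;> simp [b, h]
      map_smul' := fun c v => by
        ext n
        by_cases h : n = 0 <;> simp [b, h] }
  refine ⟨B₀.mkContinuous 1 fun v => ?_, LinearMap.mkContinuous_norm_le _ zero_le_one _, ?_⟩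
  · rw [one_mul]
    exact (BoundedContinuousFunction.norm_le (norm_nonneg v)).2 (hb v)
  · ext v n
    simp [leftShift_apply, B₀, b]

theorem surjective_smul_one_sub {E : Type*} [NormedAddCommGroup E] [NormedSpace ℂ E]
    [CompleteSpace E] (c : ℂ) (T : E →L[ℂ] E) (h : ‖T‖ < ‖c‖) :
    Function.Surjective (c • 1 - T : E →L[ℂ] E) := by
  have hc : c ∈ resolventSet ℂ T :=
    spectrum.mem_resolventSet_of_norm_lt_mul <|
      (mul_le_of_le_one_right (norm_nonneg T) ContinuousLinearMap.norm_id_le).trans_lt h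
  rw [spectrum.mem_resolventSet_iff, Algebra.algebraMap_eq_smul_one] at hc
  obtain ⟨U, hU⟩ := hc
  intro v
  refine ⟨(↑U⁻¹ : E →L[ℂ] E) v, ?_⟩
  rw [← hU, ← mul_apply_eq_comp, Units.mul_inv, one_apply_eq_self]

/-- For `|a| > ρ` the operator is invertible by a Neumann series. For `|a| < ρ`, a contractive right
inverse `B` of the shift `S` gives `(ρ S - a) B = ρ - a B`, which is invertible. -/
theorem surjective_smul_leftShift_sub (ρ : ℝ) (hρ : 0 < ρ) (a : ℂ) (ha : ‖a‖ ≠ ρ) :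
    Function.Surjective ((ρ : ℂ) • leftShift - a • 1 : (ℕ →ᵇ ℂ) →L[ℂ] (ℕ →ᵇ ℂ)) := by
  have hρn : ‖(ρ : ℂ)‖ = ρ := by rw [Complex.norm_real, Real.norm_of_nonneg hρ.le]
  rcases lt_or_gt_of_ne ha with h | h
  · obtain ⟨B, hB, hSB⟩ := exists_leftShift_mul_eq_one
    have h1 := surjective_smul_one_sub ρ (a • B) (by
      rw [norm_smul, hρn]
      exact (mul_le_of_le_one_right (norm_nonneg a) hB).trans_lt h)
    have h2 : ((ρ : ℂ) • 1 - a • B : (ℕ →ᵇ ℂ) →L[ℂ] (ℕ →ᵇ ℂ)) =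
        ((ρ : ℂ) • leftShift - a • 1) * B := by
      refine ContinuousLinearMap.ext fun v => ?_
      have hv : leftShift (B v) = v := DFunLike.congr_fun hSB v
      change (ρ : ℂ) • v - a • B v = (ρ : ℂ) • leftShift (B v) - a • B v
      rw [hv]
    intro v
    obtain ⟨u, hu⟩ := h1 v
    exact ⟨B u, by rw [← hu, h2, mul_apply_eq_comp]⟩
  · have h1 := surjective_smul_one_sub a ((ρ : ℂ) • leftShift) (by
      rw [norm_smul, hρn]
      exact (mul_le_of_le_one_right hρ.le norm_leftShift_le).trans_lt h)
    intro v
    obtain ⟨u, hu⟩ := h1 (-v)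
    exact ⟨u, by rw [← neg_sub (a • 1), neg_apply, hu, neg_neg]⟩

theorem surjective_aeval_smul_leftShift (ρ : ℝ) (hρ : 0 < ρ) (P : ℂ[X]) (hP : P ≠ 0)
    (hroots : ∀ a ∈ P.roots, ‖a‖ ≠ ρ) :
    Function.Surjective (aeval ((ρ : ℂ) • leftShift) P) := by
  have key : ∀ s : Multiset ℂ, (∀ a ∈ s, ‖a‖ ≠ ρ) →
      Function.Surjective (aeval ((ρ : ℂ) • leftShift) (s.map fun a => X - C a).prod) := by
    intro s
    induction s using Multiset.induction with
    | empty => intro _ v; exact ⟨v, by simp⟩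
    | cons a s ih =>
      intro hs v
      obtain ⟨u, hu⟩ := surjective_smul_leftShift_sub ρ hρ a (hs a (Multiset.mem_cons_self a s)) v
      obtain ⟨w, hw⟩ := ih (fun b hb => hs b (Multiset.mem_cons_of_mem hb)) u
      refine ⟨w, ?_⟩
      rw [Multiset.map_cons, Multiset.prod_cons, map_mul, mul_apply_eq_comp, hw,
        map_sub, aeval_X, aeval_C, Algebra.algebraMap_eq_smul_one, hu]
  intro v
  have hl : P.leadingCoeff ≠ 0 := leadingCoeff_ne_zero.2 hP
  obtain ⟨u, hu⟩ := key _ hroots (P.leadingCoeff⁻¹ • v)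
  refine ⟨u, ?_⟩
  conv_lhs => rw [(IsAlgClosed.splits P).eq_prod_roots]
  rw [map_mul, mul_apply_eq_comp, hu, aeval_C, Algebra.algebraMap_eq_smul_one,
    smul_apply, one_apply_eq_self, smul_smul,
    mul_inv_cancel₀ hl, one_smul]

/-! ### Persistence of solutions under perturbation -/

/-- Multiplication by the decaying sequence `r` is not onto, so the equation has to be divided by
`r` before linearising; `g` is the quotient. -/
theorem exists_hasStrictFDerivAt_prod_eq {A ι : Type*} [NormedCommRing A] [NormedAlgebra ℂ A]
    (r : A) (w : ι → A →L[ℂ] A) (s : Finset ι) :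
    ∃ g : A → A, g 0 = 0 ∧ HasStrictFDerivAt g (∑ j ∈ s, w j) 0 ∧
      ∀ v, ∏ j ∈ s, (1 + r * w j v) = 1 + r * g v := by
  classical
  induction s using Finset.induction_on with
  | empty => exact ⟨fun _ => 0, rfl, by simpa using hasStrictFDerivAt_const 0 0, by simp⟩
  | insert a s ha ih =>
    obtain ⟨g, hg0, hg, hprod⟩ := ih
    refine ⟨fun v => w a v + g v + r * (w a v * g v), by simp [hg0], ?_, fun v => ?_⟩
    · have h := ((w a).hasStrictFDerivAt.add hg).add
        (((w a).hasStrictFDerivAt.mul hg).const_mul r)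
      rw [Finset.sum_insert ha]
      refine h.congr_fderiv ?_
      simp [hg0]
    · rw [Finset.prod_insert ha, hprod]
      ring

/-- The map `(ε, v) ↦ (ε, Φ (ε, v))` has surjective derivative at `0`, hence is open there and
attains `(ε, 0)` for all small `ε`. -/
theorem exists_ne_zero_eq_zero_of_surjective {E F : Type*}
    [NormedAddCommGroup E] [NormedSpace ℂ E] [CompleteSpace E]
    [NormedAddCommGroup F] [NormedSpace ℂ F] [CompleteSpace F]
    {Φ : ℂ × E → F} {Φ' : ℂ × E →L[ℂ] F} (hΦ : HasStrictFDerivAt Φ Φ' 0) (h0 : Φ 0 = 0)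
    (hsurj : Function.Surjective fun v => Φ' (0, v)) {δ : ℝ} (hδ : 0 < δ) :
    ∃ ε : ℂ, ε ≠ 0 ∧ ∃ v : E, ‖v‖ < δ ∧ Φ (ε, v) = 0 := by
  have hG : HasStrictFDerivAt (fun x : ℂ × E => (x.1, Φ x))
      ((ContinuousLinearMap.fst ℂ ℂ E).prod Φ') 0 := hasStrictFDerivAt_fst.prodMk hΦ
  have hr : ((ContinuousLinearMap.fst ℂ ℂ E).prod Φ').range = ⊤ := by
    refine LinearMap.range_eq_top.2 ?_
    rintro ⟨c, b⟩
    obtain ⟨v, hv⟩ := hsurj (b - Φ' (c, 0))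
    refine ⟨(c, v), ?_⟩
    have e : ((c, v) : ℂ × E) = (c, 0) + (0, v) := by simp
    have hv' : Φ' (c, v) = b := by
      rw [e, map_add, show Φ' (0, v) = b - Φ' (c, 0) from hv]
      abel
    simp [hv']
  have hmap := hG.map_nhds_eq_of_surj hr
  have hball : Metric.ball (0 : ℂ × E) δ ∈ nhds (0 : ℂ × E) := Metric.ball_mem_nhds _ hδ
  have himg := image_mem_map (m := fun x : ℂ × E => (x.1, Φ x)) hball
  rw [hmap] at himg
  simp only [Prod.fst_zero, h0] at himg
  have hc : Tendsto (fun ε : ℂ => (ε, (0 : F))) (nhds 0) (nhds (0, 0)) :=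
    (Continuous.prodMk_left (0 : F)).tendsto 0
  have hev : ∀ᶠ ε in nhdsWithin (0 : ℂ) {0}ᶜ, (ε, (0 : F)) ∈
      (fun x : ℂ × E => (x.1, Φ x)) '' Metric.ball 0 δ :=
    (hc.eventually_mem himg).filter_mono nhdsWithin_le_nhds
  obtain ⟨ε, hε, hε0⟩ := (hev.and self_mem_nhdsWithin).exists
  obtain ⟨⟨c, v⟩, hx, hxe⟩ := hε
  simp only [Prod.mk.injEq] at hxe
  obtain ⟨rfl, hΦv⟩ := hxe
  refine ⟨c, hε0, v, ?_, hΦv⟩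
  rw [mem_ball_zero_iff] at hx
  exact (le_max_right _ _).trans_lt hx

theorem exists_prod_eq_perturbed_pow {A : Type*} [NormedCommRing A] [NormedAlgebra ℂ A]
    [CompleteSpace A] (d : ℕ) (a : ℕ → ℂ) (r e : A) (w : ℕ → A →L[ℂ] A)
    (hsurj : Function.Surjective (∑ j ∈ Finset.range d, w j - (d : ℂ) • 1 : A →L[ℂ] A))
    {δ : ℝ} (hδ : 0 < δ) :
    ∃ ε : ℂ, ε ≠ 0 ∧ ∃ v : A, ‖v‖ < δ ∧ ∏ j ∈ Finset.range d, (1 + r * w j v) =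
      (1 + r * v) ^ d +
        ∑ i ∈ Finset.range d, (a i * ε ^ (d - i)) • ((r * e) ^ (d - i) * (1 + r * v) ^ i) := by
  obtain ⟨g, hg0, hg, hgp⟩ := exists_hasStrictFDerivAt_prod_eq r w (Finset.range d)
  obtain ⟨f, hf0, hf, hfp⟩ :=
    exists_hasStrictFDerivAt_prod_eq r (fun _ => (1 : A →L[ℂ] A)) (Finset.range d)
  -- The lower-order terms divided by `r`: since `i < d`, each contains a factor `r * e`, of which
  -- `e` is kept.
  let h : ℂ × A → A := fun x => ∑ i ∈ Finset.range d,
    (a i * x.1 ^ (d - i)) • (e * (r * e) ^ (d - i - 1) * (1 + r * x.2) ^ i)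
  have hh : ContDiff ℂ 1 h := by
    refine ContDiff.sum fun i _ => ?_
    fun_prop
  have hh' : HasStrictFDerivAt h (fderiv ℂ h 0) 0 :=
    hh.contDiffAt.hasStrictFDerivAt one_ne_zero
  have hv0 : ∀ v, h (0, v) = 0 := by
    intro v
    refine Finset.sum_eq_zero fun i hi => ?_
    have : d - i ≠ 0 := by have := Finset.mem_range.1 hi; omega
    simp [this]
  -- `h` vanishes on `ε = 0`, so it does not affect the linearisation in `v`.
  have hd0 : ∀ v, fderiv ℂ h 0 (0, v) = 0 := by
    intro v
    have h1 : HasFDerivAt (h ∘ ContinuousLinearMap.inr ℂ ℂ A)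
        ((fderiv ℂ h 0).comp (ContinuousLinearMap.inr ℂ ℂ A)) 0 :=
      HasFDerivAt.comp 0
        (by rw [map_zero]; exact hh'.hasFDerivAt)
        (ContinuousLinearMap.inr ℂ ℂ A).hasFDerivAt
    have h2 : h ∘ ContinuousLinearMap.inr ℂ ℂ A = fun _ => 0 := by
      funext v
      simpa using hv0 v
    rw [h2] at h1
    have h3 := h1.unique (hasFDerivAt_const 0 0)
    simpa using DFunLike.congr_fun h3 v
  have hg2 : HasStrictFDerivAt (fun x : ℂ × A => g x.2)
      ((∑ j ∈ Finset.range d, w j).comp (ContinuousLinearMap.snd ℂ ℂ A)) 0 :=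
    HasStrictFDerivAt.comp (g := g) (f := Prod.snd) 0 hg hasStrictFDerivAt_snd
  have hf2 : HasStrictFDerivAt (fun x : ℂ × A => f x.2)
      ((∑ j ∈ Finset.range d, (1 : A →L[ℂ] A)).comp (ContinuousLinearMap.snd ℂ ℂ A)) 0 :=
    HasStrictFDerivAt.comp (g := f) (f := Prod.snd) 0 hf hasStrictFDerivAt_snd
  obtain ⟨ε, hε, v, hv, hΦ⟩ := exists_ne_zero_eq_zero_of_surjective ((hg2.sub hf2).sub hh')
    (by
      change g 0 - f 0 - h (0, 0) = 0
      rw [hg0, hf0, hv0, sub_zero, sub_zero]) (by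
      intro b
      obtain ⟨v, hv⟩ := hsurj b
      refine ⟨v, ?_⟩
      rw [← hv]
      simp [hd0, Nat.cast_smul_eq_nsmul]) hδ
  refine ⟨ε, hε, v, hv, ?_⟩
  have hfp' : (1 + r * v) ^ d = 1 + r * f v := by simpa using hfp v
  have hrh : ∑ i ∈ Finset.range d,
      (a i * ε ^ (d - i)) • ((r * e) ^ (d - i) * (1 + r * v) ^ i) = r * h (ε, v) := by
    rw [Finset.mul_sum]
    refine Finset.sum_congr rfl fun i hi => ?_
    obtain ⟨k, hk⟩ : ∃ k, d - i = k + 1 :=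
      ⟨d - i - 1, by have := Finset.mem_range.1 hi; omega⟩
    rw [mul_smul_comm, hk, Nat.add_sub_cancel]
    congr 1
    ring
  have hΦ' : g v - f v - h (ε, v) = 0 := hΦ
  rw [hgp, hrh, hfp']
  linear_combination r * hΦ'

/-! ### A divergent solution of the recurrence -/

theorem exists_boundedContinuousFunction_geometric (c : ℂ) (hc : ‖c‖ ≤ 1) :
    ∃ r : ℕ →ᵇ ℂ, ∀ n, r n = c ^ n :=
  ⟨BoundedContinuousFunction.ofNormedAddCommGroup (fun n => c ^ n)
    continuous_of_discreteTopology 1 fun n => by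
      rw [norm_pow]
      exact pow_le_one₀ (norm_nonneg c) hc, fun _ => rfl⟩

theorem aeval_smul_leftShift_apply (c b m : ℂ) (j : ℕ) (v : ℕ →ᵇ ℂ) (n : ℕ) :
    aeval (c • leftShift) (C b * (1 - C m * X ^ j)) v n =
      b * (v n - m * (c ^ j * v (n + j))) := by
  rw [map_mul, map_sub, map_mul, map_pow, aeval_X, aeval_C, aeval_C, map_one,
    Algebra.algebraMap_eq_smul_one, Algebra.algebraMap_eq_smul_one,
    ← smul_leftShift_pow_apply c v j n]
  rfl

/-- The characteristic polynomial of the linearisation of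
`∏ (y k - y (k + j + 1)) = (y k) ^ d` along the solution `y k = μ ^ k` does not vanish. -/
theorem characteristic_ne_zero (d : ℕ) (hd : d ≠ 0) (μ : ℂ) (hμ : μ ≠ 0) (β : ℕ → ℂ)
    (hβ : ∀ j ∈ Finset.range d, β j ≠ 0) (c : ℂ) :
    ∑ j ∈ Finset.range d, C (β j) * (1 - C (μ ^ (j + 1)) * X ^ (j + 1)) - C c ≠ 0 := by
  intro h
  obtain ⟨k, rfl⟩ := Nat.exists_eq_succ_of_ne_zero hd
  -- Only the last summand reaches the top degree.
  have h1 := congrArg (fun q : ℂ[X] => q.coeff (k + 1)) h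
  simp only [coeff_sub, finsetSum_coeff, coeff_C_mul, coeff_one, coeff_X_pow, coeff_C,
    coeff_zero, Nat.succ_ne_zero, if_false, sub_zero, zero_sub, Nat.succ_eq_add_one,
    add_left_inj] at h1
  simp only [mul_ite, mul_one, mul_zero, mul_neg, neg_eq_zero, Finset.sum_neg_distrib,
    Finset.sum_ite_eq, Finset.mem_range, Nat.lt_succ_self, if_true] at h1
  exact mul_ne_zero (hβ k (by simp)) (pow_ne_zero _ hμ) h1

theorem exists_tendsto_atTop_recurrence (d : ℕ) (hd : 2 ≤ d) (p : ℂ[X]) (hmonic : p.Monic)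
    (hdeg : p.natDegree = d) :
    ∃ y : ℕ → ℂ, Tendsto (fun k => ‖y k‖) atTop atTop ∧
      ∀ k, ∏ j ∈ Finset.range d, (y k - y (k + (j + 1))) = p.eval (y k) := by
  obtain ⟨μ, hμ1, hμ⟩ := exists_prod_one_sub_pow_eq_one d hd
  have hμpos : 0 < ‖μ‖ := one_pos.trans hμ1
  have hμ0 : μ ≠ 0 := norm_pos_iff.1 hμpos
  have hα : ∀ j ∈ Finset.range d, 1 - μ ^ (j + 1) ≠ 0 := by
    refine Finset.prod_ne_zero_iff.1 ?_
    rw [hμ]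
    exact one_ne_zero
  set Q : ℕ → ℂ[X] :=
    fun j => C (1 - μ ^ (j + 1))⁻¹ * (1 - C (μ ^ (j + 1)) * X ^ (j + 1)) with hQ
  have hP0 : ∑ j ∈ Finset.range d, Q j - C (d : ℂ) ≠ 0 :=
    characteristic_ne_zero d (by omega) μ hμ0 (fun j => (1 - μ ^ (j + 1))⁻¹)
      (fun j hj => inv_ne_zero (hα j hj)) d
  -- `ρ < 1` keeps `r = (ρ^n)` bounded, and `ρ > 1/|μ|` does the same for `e = ((μ ρ)^(-n))`.
  obtain ⟨ρ, ⟨hρ1, hρ2⟩, hρ⟩ := (Set.Ioo_infinite (inv_lt_one_of_one_lt₀ hμ1)).exists_notMem_finset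
    ((∑ j ∈ Finset.range d, Q j - C (d : ℂ)).roots.toFinset.image fun a => ‖a‖)
  have hρ0 : 0 < ρ := (inv_pos.2 hμpos).trans hρ1
  have hρn : ‖(ρ : ℂ)‖ = ρ := by rw [Complex.norm_real, Real.norm_of_nonneg hρ0.le]
  have hsurj := surjective_aeval_smul_leftShift ρ hρ0 _ hP0 fun a ha hna =>
    hρ (Finset.mem_image.2 ⟨a, Multiset.mem_toFinset.2 ha, hna⟩)
  rw [map_sub, map_sum, aeval_C, Algebra.algebraMap_eq_smul_one] at hsurj
  obtain ⟨r, hr⟩ := exists_boundedContinuousFunction_geometric ρ (by rw [hρn]; exact hρ2.le)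
  obtain ⟨e, he⟩ := exists_boundedContinuousFunction_geometric (μ * ρ)⁻¹ (by
    rw [norm_inv, norm_mul, hρn]
    refine inv_le_one_of_one_le₀ ?_
    rw [inv_lt_iff_one_lt_mul₀' hμpos] at hρ1
    exact hρ1.le)
  have hre : ∀ n, (ρ : ℂ) ^ n * e n = (μ ^ n)⁻¹ := by
    intro n
    have : (ρ : ℂ) ≠ 0 := by exact_mod_cast hρ0.ne'
    rw [he, ← mul_pow, mul_inv, mul_left_comm, mul_inv_cancel₀ this, mul_one, inv_pow]
  obtain ⟨ε, hε, v, hv, heq⟩ := exists_prod_eq_perturbed_pow d p.coeff r e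
    (fun j => aeval ((ρ : ℂ) • leftShift) (Q j)) hsurj (one_half_pos (α := ℝ))
  have hu : ∀ n, ‖(ρ : ℂ) ^ n * v n‖ ≤ 1 / 2 := by
    intro n
    rw [norm_mul, norm_pow, hρn]
    exact (mul_le_of_le_one_left (norm_nonneg _) (pow_le_one₀ hρ0.le hρ2.le)).trans
      ((v.norm_coe_le_norm n).trans hv.le)
  refine ⟨fun n => ε⁻¹ * μ ^ n * (1 + ρ ^ n * v n), ?_, fun n => ?_⟩
  · have h1 : Tendsto (fun n : ℕ => ‖ε‖⁻¹ * (1 / 2) * ‖μ‖ ^ n) atTop atTop :=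
      (tendsto_pow_atTop_atTop_of_one_lt hμ1).const_mul_atTop
        (mul_pos (inv_pos.2 (norm_pos_iff.2 hε)) one_half_pos)
    refine tendsto_atTop_mono (fun n => ?_) h1
    have h2 : 1 / 2 ≤ ‖1 + (ρ : ℂ) ^ n * v n‖ := by
      have := norm_sub_le_norm_add (1 : ℂ) ((ρ : ℂ) ^ n * v n)
      rw [norm_one] at this
      linarith [hu n]
    rw [norm_mul, norm_mul, norm_inv, norm_pow, mul_right_comm]
    gcongr
  · have h1 := DFunLike.congr_fun heq n
    have h2 : ∏ j ∈ Finset.range d, (1 + (ρ : ℂ) ^ n * ((1 - μ ^ (j + 1))⁻¹ *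
          (v n - μ ^ (j + 1) * ((ρ : ℂ) ^ (j + 1) * v (n + (j + 1)))))) =
        (1 + (ρ : ℂ) ^ n * v n) ^ d + ∑ i ∈ Finset.range d,
          p.coeff i * ε ^ (d - i) * (((μ ^ n)⁻¹) ^ (d - i) * (1 + (ρ : ℂ) ^ n * v n) ^ i) := by
      simpa only [BoundedContinuousFunction.coe_prod, Finset.prod_apply,
        BoundedContinuousFunction.coe_add, BoundedContinuousFunction.coe_sum, Finset.sum_apply,
        BoundedContinuousFunction.coe_mul, BoundedContinuousFunction.coe_one, Pi.add_apply,
        Pi.mul_apply, Pi.one_apply, BoundedContinuousFunction.coe_pow, Pi.pow_apply,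
        BoundedContinuousFunction.coe_smul, smul_eq_mul, hre, hr, hQ,
        aeval_smul_leftShift_apply] using h1
    have hμn : μ ^ n ≠ 0 := pow_ne_zero _ hμ0
    set x := 1 + (ρ : ℂ) ^ n * v n with hx
    have h3 : ∏ j ∈ Finset.range d, (ε⁻¹ * μ ^ n * x -
          ε⁻¹ * μ ^ (n + (j + 1)) * (1 + (ρ : ℂ) ^ (n + (j + 1)) * v (n + (j + 1)))) =
        (ε⁻¹ * μ ^ n) ^ d * ∏ j ∈ Finset.range d, (1 + (ρ : ℂ) ^ n * ((1 - μ ^ (j + 1))⁻¹ *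
          (v n - μ ^ (j + 1) * ((ρ : ℂ) ^ (j + 1) * v (n + (j + 1)))))) := by
      have hc : (ε⁻¹ * μ ^ n) ^ d =
          ∏ j ∈ Finset.range d, (ε⁻¹ * μ ^ n * (1 - μ ^ (j + 1))) := by
        rw [Finset.prod_mul_distrib, hμ, mul_one, Finset.prod_const, Finset.card_range]
      rw [hc, ← Finset.prod_mul_distrib]
      refine Finset.prod_congr rfl fun j hj => ?_
      have := mul_inv_cancel₀ (hα j hj)
      rw [hx, pow_add, pow_add]
      linear_combination (-(ε⁻¹ * μ ^ n * (ρ : ℂ) ^ n *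
        (v n - μ ^ (j + 1) * ((ρ : ℂ) ^ (j + 1) * v (n + (j + 1)))))) * this
    have hpd : p.coeff d = 1 := by rw [← hdeg]; exact hmonic
    rw [h3, h2, eval_eq_sum_range, hdeg, Finset.sum_range_succ, hpd, one_mul, mul_add,
      ← mul_pow, add_comm, Finset.mul_sum]
    congr 1
    refine Finset.sum_congr rfl fun i hi => ?_
    obtain ⟨k, rfl⟩ := Nat.exists_eq_add_of_le (Finset.mem_range.1 hi).le
    rw [Nat.add_sub_cancel_left, pow_add, mul_pow _ x]
    have hk : (ε⁻¹ * μ ^ n) ^ k * (ε ^ k * ((μ ^ n)⁻¹) ^ k) = 1 := by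
      rw [← mul_pow, ← mul_pow]
      field_simp
      exact one_pow _
    linear_combination (ε⁻¹ * μ ^ n) ^ i * p.coeff i * x ^ i * hk

/-! ### From the recurrence to Gauss–Seidel orbits -/

/-- When coordinate `i` is updated, the other current values are the next `d - 1` terms of `y`, up
to a cyclic reindexing. -/
theorem prod_erase_cyclic {d : ℕ} (y : ℕ → ℂ) (n : ℕ) (i : Fin d) :
    ∏ j ∈ Finset.univ.erase i,
        (y (n + i) - if j < i then y (n + d + j) else y (n + j)) =
      ∏ l ∈ Finset.range (d - 1), (y (n + i) - y (n + i + (l + 1))) := by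
  refine Finset.prod_bij' (fun j _ => if j < i then d - i + j - 1 else j - i - 1)
    (fun l _ => ⟨(i + (l + 1)) % d, Nat.mod_lt _ i.pos⟩) ?_ ?_ ?_ ?_ ?_
  · intro j hj
    have hne : (j : ℕ) ≠ i := fun h => (Finset.mem_erase.1 hj).1 (Fin.ext h)
    have := i.2
    have := j.2
    simp only [Fin.lt_def, Finset.mem_range]
    split_ifs <;> omega
  · intro l hl
    have hl := Finset.mem_range.1 hl
    have := i.2
    refine Finset.mem_erase.2 ⟨fun h => ?_, Finset.mem_univ _⟩
    have h' : (i + (l + 1)) % d = (i : ℕ) := congrArg Fin.val h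
    rcases lt_or_ge (i + (l + 1)) d with hc | hc
    · rw [Nat.mod_eq_of_lt hc] at h'; omega
    · rw [Nat.mod_eq_sub_mod hc, Nat.mod_eq_of_lt (by omega)] at h'; omega
  · intro j hj
    have hne : (j : ℕ) ≠ i := fun h => (Finset.mem_erase.1 hj).1 (Fin.ext h)
    have := i.2
    have := j.2
    refine Fin.ext ?_
    change (i + ((if j < i then d - i + j - 1 else j - i - 1) + 1)) % d = (j : ℕ)
    split_ifs with h
    · have h : (j : ℕ) < i := h
      rw [show (i : ℕ) + (d - i + j - 1 + 1) = j + d by omega, Nat.add_mod_right,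
        Nat.mod_eq_of_lt j.2]
    · have h : ¬ (j : ℕ) < i := h
      rw [show (i : ℕ) + (j - i - 1 + 1) = j by omega, Nat.mod_eq_of_lt j.2]
  · intro l hl
    have hl := Finset.mem_range.1 hl
    have := i.2
    change (if (i + (l + 1)) % d < i then d - i + (i + (l + 1)) % d - 1
      else (i + (l + 1)) % d - i - 1) = l
    rcases lt_or_ge (i + (l + 1)) d with hc | hc
    · rw [Nat.mod_eq_of_lt hc, if_neg (by omega)]; omega
    · rw [Nat.mod_eq_sub_mod hc, Nat.mod_eq_of_lt (by omega), if_pos (by omega)]; omega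
  · intro j hj
    have hne : (j : ℕ) ≠ i := fun h => (Finset.mem_erase.1 hj).1 (Fin.ext h)
    have := i.2
    have := j.2
    split_ifs with h
    · have h : (j : ℕ) < i := h
      rw [show n + d + (j : ℕ) = n + i + (d - i + j - 1 + 1) by omega]
    · have h : ¬ (j : ℕ) < i := h
      rw [show n + (j : ℕ) = n + i + (j - i - 1 + 1) by omega]

theorem gswPartial_of_recurrence {d : ℕ} (p : ℂ[X]) (y : ℕ → ℂ)
    (hne : ∀ k, p.eval (y k) ≠ 0)
    (hy : ∀ k, ∏ j ∈ Finset.range d, (y k - y (k + (j + 1))) = p.eval (y k))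
    (n k : ℕ) (hk : k ≤ d) (i : Fin d) :
    gswPartial p (fun i : Fin d => y (n + i)) k i =
      if (i : ℕ) < k then y (n + d + i) else y (n + i) := by
  induction k generalizing i with
  | zero => simp [gswPartial]
  | succ k ih =>
    have hkd : k < d := hk
    have ih := ih hkd.le
    rw [gswPartial, dif_pos hkd]
    by_cases hik : i = ⟨k, hkd⟩
    · subst hik
      rw [Function.update_self, if_pos (Nat.lt_succ_self k), weierstrassUpdate]
      simp only [ih, lt_self_iff_false, if_false]
      have hprod := prod_erase_cyclic y n (⟨k, hkd⟩ : Fin d)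
      simp only [Fin.lt_def] at hprod
      rw [hprod]
      have hrec := hy (n + k)
      -- The last factor of the recurrence is `y_k - y_{k+d}`; the others form the Weierstrass
      -- denominator, nonzero because `p(y_k) ≠ 0`.
      obtain ⟨m, rfl⟩ := Nat.exists_eq_succ_of_ne_zero (Nat.ne_zero_of_lt hkd)
      rw [Finset.prod_range_succ] at hrec
      have h0 := hne (n + k)
      rw [← hrec] at h0
      rw [Nat.succ_eq_add_one, Nat.add_sub_cancel, ← hrec,
        mul_div_cancel_left₀ _ (left_ne_zero_of_mul h0), sub_sub_cancel]
      congr 1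
      omega
    · have hik' : (i : ℕ) ≠ k := fun h => hik (Fin.ext h)
      rw [Function.update_of_ne hik, ih]
      by_cases h : (i : ℕ) < k
      · rw [if_pos h, if_pos (by omega)]
      · rw [if_neg h, if_neg (by omega)]

theorem isGSWOrbit_of_recurrence {d : ℕ} (p : ℂ[X]) (y : ℕ → ℂ)
    (hne : ∀ k, p.eval (y k) ≠ 0)
    (hy : ∀ k, ∏ j ∈ Finset.range d, (y k - y (k + (j + 1))) = p.eval (y k)) :
    IsGSWOrbit p (fun m (i : Fin d) => y (m * d + i)) := by
  refine fun m => ⟨fun i => ?_, ?_⟩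
  · simp only [gswPartial_of_recurrence p y hne hy (m * d) i i.2.le, lt_self_iff_false, if_false]
    have hprod := prod_erase_cyclic y (m * d) i
    simp only [Fin.lt_def] at hprod
    rw [hprod]
    have h0 := hne (m * d + i)
    rw [← hy, Finset.prod_ne_zero_iff] at h0
    refine Finset.prod_ne_zero_iff.2 fun l hl => h0 l ?_
    have := Finset.mem_range.1 hl
    exact Finset.mem_range.2 (by omega)
  · funext i
    rw [GSW, gswPartial_of_recurrence p y hne hy (m * d) d le_rfl, if_pos i.2, ← Nat.succ_mul]

theorem theorem2 (d : ℕ) (hd : 3 ≤ d) (p : ℂ[X]) (hmonic : p.Monic)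
    (hdeg : p.natDegree = d) (hroots : p.roots.Nodup) :
    ∃ z : ℕ → Fin d → ℂ, IsGSWOrbit p z ∧ Tendsto (fun m => ‖z m‖) atTop atTop := by
  obtain ⟨y, hy, hrec⟩ := exists_tendsto_atTop_recurrence d (by omega) p hmonic hdeg
  have hp : 0 < p.degree := natDegree_pos_iff_degree_pos.1 (by omega)
  -- Start the orbit late enough that `p` has no zero along it; the recurrence is shift invariant.
  obtain ⟨K, hK⟩ := eventually_atTop.1
    ((p.tendsto_norm_atTop hp hy).eventually_gt_atTop 0)
  refine ⟨fun m i => y (K + (m * d + i)), isGSWOrbit_of_recurrence p (fun k => y (K + k))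
    (fun k => norm_pos_iff.1 (hK _ (Nat.le_add_right K k))) fun k => ?_, ?_⟩
  · simpa only [add_assoc] using hrec (K + k)
  · have h1 : Tendsto (fun m => K + m * d) atTop atTop :=
      tendsto_atTop_mono (fun m => (Nat.le_mul_of_pos_right m (by omega : 0 < d)).trans
        (Nat.le_add_left _ K)) tendsto_id
    exact tendsto_atTop_mono
      (fun m => norm_le_pi_norm (fun i : Fin d => y (K + (m * d + i))) ⟨0, by omega⟩)
      (hy.comp h1)
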